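/- For an entire function $f:\mathbb{C}\to\mathbb{C}$, let its order $\alpha(f)\in[0,+\infty]$ be the infimum of all real numbers $\alpha\ge 0$ such that $\log\max_{|z|\le r}|f(z)|\le O(r^\alpha)$ as $r\to\infty$ (with $\alpha(f)=+\infty$ if there is no such $\alpha$). Let $w=\sqrt{z^2-1}$, and define the degree of the zero polynomial to be $-1$. Theorem. Let $x,y$ be entire functions with $x^2-(z^2-1)y^2=1$, given by $$x+yw=\epsilon\cdot(z+w)^n\exp(hw)$$ for some $\epsilon\in\{-1,1\}$, some $n\in\mathbb{Z}$ and some entire function $h$. Let $\rho\ge 0$ be a real number. If $\alpha(y)\le\rho$, then $h$ is a polynomial of degree at most $\lfloor\rho\rfloor-1$. -/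

import Mathlib

/-- The maximum modulus `max_{|z| ≤ r} |f z|`. -/
noncomputable def maxModulus (f : ℂ → ℂ) (r : ℝ) : ℝ :=
  sSup ((fun z : ℂ => ‖f z‖) '' Metric.closedBall 0 r)

/-- `log max_{|z| ≤ r} |f z| ≤ O(r ^ α)` as `r → ∞`. -/
def HasGrowthBound (f : ℂ → ℂ) (α : ℝ) : Prop :=
  ∃ C : ℝ, ∀ᶠ r : ℝ in Filter.atTop, Real.log (maxModulus f r) ≤ C * r ^ α

/-- The order of an entire function: the infimum of all real `α ≥ 0` admitted by the growth bound,
taken in the extended reals, so that it is `⊤` if there is no such `α`. -/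
noncomputable def entireOrder (f : ℂ → ℂ) : EReal :=
  sInf {a : EReal | ∃ α : ℝ, 0 ≤ α ∧ HasGrowthBound f α ∧ a = (α : EReal)}

/-- `(x, y)` is a solution, in the ring of entire functions, of `X² - (z² - 1) Y² = 1`. -/
structure IsEntirePellSolution (x y : ℂ → ℂ) : Prop where
  entire_x : Differentiable ℂ x
  entire_y : Differentiable ℂ y
  pell : ∀ z : ℂ, x z ^ 2 - (z ^ 2 - 1) * y z ^ 2 = 1

/-- The degree of a complex polynomial, where the zero polynomial has degree `-1`. -/
noncomputable def intDegree (p : Polynomial ℂ) : ℤ :=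
  open Classical in if p = 0 then -1 else (p.natDegree : ℤ)

open Filter Metric

/-! Replacing w by -w inverts x + yw, so a bound on y controls Re(hw) from both sides: |Re(hw)| =
O(r^α) for some α < ⌊ρ⌋ + 1. Although w is not entire, (hw)² = (z² - 1)h² is, and its real part is
at most (Re(hw))². Borel–Carathéodory turns this into a bound O(r^(2α)) on its modulus; dividing by
z² - 1 gives h = O(r^(α-1)), and Cauchy's estimates kill the Taylor coefficients of h from index ⌊ρ⌋
on. -/

/-- An entire function which is `O(r ^ β)` on the circles `|z| = r` is a polynomial of degree
less than any natural number exceeding `β`. -/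
theorem exists_polynomial_of_norm_le_rpow {f : ℂ → ℂ} (hf : Differentiable ℂ f) {K β : ℝ} {N : ℕ}
    (hN : β < N) (hK : ∀ᶠ r : ℝ in atTop, ∀ z : ℂ, ‖z‖ = r → ‖f z‖ ≤ K * r ^ β) :
    ∃ p : Polynomial ℂ, (∀ z, f z = p.eval z) ∧ p.degree < N := by
  have hzero : ∀ k : ℕ, N ≤ k → iteratedDeriv k f 0 = 0 := by
    intro k hk
    have hkβ : 0 < (k : ℝ) - β := by
      have : (N : ℝ) ≤ k := by exact_mod_cast hk
      linarith
    have hlim : Tendsto (fun r : ℝ => (k.factorial * K : ℝ) * r ^ (-((k : ℝ) - β))) atTop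
        (nhds 0) := by
      simpa using (tendsto_rpow_neg_atTop hkβ).const_mul (k.factorial * K : ℝ)
    have hle : ‖iteratedDeriv k f 0‖ ≤ 0 := by
      refine ge_of_tendsto hlim ?_
      filter_upwards [hK, eventually_gt_atTop 0] with r hr hr0
      have hc := Complex.norm_iteratedDeriv_le_of_forall_mem_sphere_norm_le k hr0
        (hf.diffContOnCl (s := ball 0 r)) (fun z hz => hr z (mem_sphere_zero_iff_norm.1 hz))
      refine hc.trans_eq ?_
      rw [neg_sub, Real.rpow_sub hr0, Real.rpow_natCast]
      ring
    exact norm_le_zero_iff.1 hle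
  refine ⟨∑ k ∈ Finset.range N,
    Polynomial.monomial k ((k.factorial : ℂ)⁻¹ * iteratedDeriv k f 0), fun z => ?_, ?_⟩
  · rw [← Complex.taylorSeries_eq_of_entire' 0 z hf, tsum_eq_sum (s := Finset.range N)]
    · simp [Polynomial.eval_finsetSum]
    · intro k hk
      rw [hzero k (by simpa using hk)]
      simp
  · refine Polynomial.mem_degreeLT.1 (Submodule.sum_mem _ fun k hk => Polynomial.mem_degreeLT.2 ?_)
    exact (Polynomial.degree_monomial_le _ _).trans_lt
      (by exact_mod_cast Finset.mem_range.1 hk)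

/-- An entire function whose real part is at most `O(r ^ γ)` on `|z| ≤ r` is itself `O(r ^ γ)`. -/
theorem exists_norm_le_rpow_of_re_le_rpow {f : ℂ → ℂ} (hf : Differentiable ℂ f) {M γ : ℝ}
    (hM : 0 < M) (hγ : 0 ≤ γ)
    (h : ∀ᶠ r : ℝ in atTop, ∀ z : ℂ, ‖z‖ ≤ r → (f z).re ≤ M * r ^ γ) :
    ∃ K : ℝ, 0 ≤ K ∧ ∀ᶠ r : ℝ in atTop, ∀ z : ℂ, ‖z‖ = r → ‖f z‖ ≤ K * r ^ γ := by
  -- Borel–Carathéodory with radius 2r at |z| = r has factors 2r/(2r - r) = 2 and (2r + r)/(2r - r)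
  -- = 3.
  refine ⟨2 * M * 2 ^ γ + 3 * ‖f 0‖, by positivity, ?_⟩
  filter_upwards [(tendsto_id.const_mul_atTop (two_pos : (0 : ℝ) < 2)).eventually h,
    eventually_ge_atTop 1] with r hr hr1 z hz
  have hr0 : 0 < r := by linarith
  have hbc := Complex.borelCaratheodory (M := M * (2 * r) ^ γ) (R := 2 * r) (z := z) (by positivity)
    hf.differentiableOn (fun u hu => hr u (by simpa using (mem_ball_zero_iff.1 hu).le))
    (by positivity) (by rw [mem_ball_zero_iff]; linarith)
  have h1 : 1 ≤ r ^ γ := Real.one_le_rpow hr1 hγ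
  calc ‖f z‖ ≤ _ := hbc
    _ = 2 * M * 2 ^ γ * r ^ γ + 3 * ‖f 0‖ := by
      rw [hz, Real.mul_rpow two_pos.le hr0.le]
      have : 2 * r - r = r := by ring
      rw [this]
      field_simp
      ring
    _ ≤ 2 * M * 2 ^ γ * r ^ γ + 3 * ‖f 0‖ * r ^ γ := by
      have := le_mul_of_one_le_right (by positivity : 0 ≤ 3 * ‖f 0‖) h1
      gcongr
    _ = _ := by ring

theorem norm_le_maxModulus {f : ℂ → ℂ} (hf : Continuous f) {r : ℝ} {z : ℂ} (hz : ‖z‖ ≤ r) :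
    ‖f z‖ ≤ maxModulus f r :=
  le_csSup ((isCompact_closedBall 0 r).bddAbove_image hf.norm.continuousOn)
    ⟨z, mem_closedBall_zero_iff.2 hz, rfl⟩

/-- A function of order less than `b` is bounded by `exp (C * r ^ α)` for some positive `α < b`. -/
theorem exists_norm_le_exp_of_entireOrder_lt {f : ℂ → ℂ} (hf : Continuous f) {b : ℝ}
    (h : entireOrder f < b) :
    ∃ α C : ℝ, 0 < α ∧ α < b ∧ 0 ≤ C ∧
      ∀ᶠ r : ℝ in atTop, ∀ z : ℂ, ‖z‖ ≤ r → ‖f z‖ ≤ Real.exp (C * r ^ α) := by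
  obtain ⟨_, ⟨a, ha, ⟨C, hC⟩, rfl⟩, hab⟩ := sInf_lt_iff.1 h
  -- Moving strictly above a makes α positive, so that r^α later dominates log r.
  obtain ⟨α, haα, hαb⟩ := exists_between (EReal.coe_lt_coe_iff.1 hab)
  refine ⟨α, max C 0, ha.trans_lt haα, hαb, le_max_right _ _, ?_⟩
  filter_upwards [hC, eventually_ge_atTop 1] with r hr hr1 z hz
  -- Since `Real.log 0 = 0`, exponentiating the bound needs a positive maximum.
  rcases (norm_nonneg (f z)).eq_or_lt with h0 | h0
  · rw [← h0]
    positivity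
  have hle := norm_le_maxModulus hf hz
  refine hle.trans ((Real.log_le_iff_le_exp (h0.trans_le hle)).1 (hr.trans ?_))
  gcongr
  exact le_max_left _ _

/-- The conjugate of the parametrization, obtained by inverting both sides. -/
theorem pell_conj {x y z w h ε : ℂ} {n : ℤ} (hw : w ^ 2 = z ^ 2 - 1)
    (hxy : x ^ 2 - (z ^ 2 - 1) * y ^ 2 = 1) (hε : ε = -1 ∨ ε = 1)
    (hdef : x + y * w = ε * (z + w) ^ n * Complex.exp (h * w)) :
    x + y * (-w) = ε * (z + -w) ^ n * Complex.exp (h * -w) := by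
  have hinv : (x + y * w) * (x + y * (-w)) = 1 := by
    rw [← hxy, ← hw]
    ring
  have hz : (z + w) ^ n * (z + -w) ^ n = 1 := by
    rw [← mul_zpow]
    have : (z + w) * (z + -w) = 1 := by linear_combination -hw
    rw [this, one_zpow]
  have he : Complex.exp (h * w) * Complex.exp (h * -w) = 1 := by
    rw [← Complex.exp_add]
    simp
  have hε2 : ε * ε = 1 := by rcases hε with rfl | rfl <;> norm_num
  refine mul_left_cancel₀ (left_ne_zero_of_mul_eq_one hinv) (hinv.trans ?_)
  rw [hdef]
  calc (1 : ℂ) = ε * ε * ((z + w) ^ n * (z + -w) ^ n) *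
        (Complex.exp (h * w) * Complex.exp (h * -w)) := by rw [hz, he, hε2]; norm_num
    _ = _ := by ring

theorem norm_zpow_le_of_mul_eq_one {a b : ℂ} {R : ℝ} (hab : a * b = 1) (ha : ‖a‖ ≤ R)
    (hb : ‖b‖ ≤ R) (n : ℤ) : ‖a ^ n‖ ≤ R ^ n.natAbs := by
  rcases Int.natAbs_eq n with hn | hn
  · rw [hn, zpow_natCast, norm_pow, Int.natAbs_natCast]
    gcongr
  · rw [hn, zpow_neg, ← inv_zpow, inv_eq_of_mul_eq_one_right hab, zpow_natCast, norm_pow,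
      Int.natAbs_neg, Int.natAbs_natCast]
    gcongr

/-- Solving for the exponential gives exp(hw) = ε(x + yw)(z - w)^n, and the Pell equation bounds x
in terms of y. Both z ± w have modulus at most 5r, so the sign of n is harmless. -/
theorem re_le_of_pell {x y z w h ε : ℂ} {n : ℤ} {r L : ℝ} (hw : w ^ 2 = z ^ 2 - 1)
    (hxy : x ^ 2 - (z ^ 2 - 1) * y ^ 2 = 1) (hε : ε = -1 ∨ ε = 1)
    (hdef : x + y * w = ε * (z + w) ^ n * Complex.exp (h * w))
    (hr : 1 ≤ r) (hz : ‖z‖ ≤ r) (hL : 0 ≤ L) (hy : ‖y‖ ≤ Real.exp L) :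
    (h * w).re ≤ L + (n.natAbs + 1) * Real.log (5 * r) := by
  have hr0 : 0 < r := by linarith
  have hE : 1 ≤ Real.exp L := Real.one_le_exp hL
  have hwr : ‖w‖ ≤ 2 * r := by
    refine (sq_le_sq₀ (norm_nonneg _) (by positivity)).1 ?_
    rw [← norm_pow, hw]
    calc ‖z ^ 2 - 1‖ ≤ ‖z ^ 2‖ + ‖(1 : ℂ)‖ := norm_sub_le _ _
      _ = ‖z‖ ^ 2 + 1 := by simp
      _ ≤ r ^ 2 + 1 := by gcongr
      _ ≤ (2 * r) ^ 2 := by nlinarith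
  have hyw : ‖y * w‖ ≤ 2 * r * Real.exp L := by
    rw [norm_mul, mul_comm]
    gcongr
  have hx : ‖x‖ ≤ 1 + 2 * r * Real.exp L := by
    refine (sq_le_sq₀ (norm_nonneg _) (by positivity)).1 ?_
    have hx2 : x ^ 2 = 1 + (y * w) ^ 2 := by linear_combination hxy + y ^ 2 * -hw
    rw [← norm_pow, hx2]
    calc ‖1 + (y * w) ^ 2‖ ≤ ‖(1 : ℂ)‖ + ‖(y * w) ^ 2‖ := norm_add_le _ _
      _ = 1 + ‖y * w‖ ^ 2 := by simp
      _ ≤ 1 + (2 * r * Real.exp L) ^ 2 := by gcongr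
      _ ≤ (1 + 2 * r * Real.exp L) ^ 2 := by
        have : 0 < r * Real.exp L := by positivity
        nlinarith
  have hsum : ‖x + y * w‖ ≤ 5 * r * Real.exp L := by
    have h1 : 1 ≤ r * Real.exp L := one_le_mul_of_one_le_of_one_le hr hE
    linarith [norm_add_le x (y * w)]
  have hprod : (z - w) * (z + w) = 1 := by linear_combination -hw
  have hpow : ‖(z - w) ^ n‖ ≤ (5 * r) ^ n.natAbs :=
    norm_zpow_le_of_mul_eq_one hprod (by linarith [norm_sub_le z w])
      (by linarith [norm_add_le z w]) n
  have hexp : Complex.exp (h * w) = ε * (x + y * w) * (z - w) ^ n := by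
    have hε2 : ε * ε = 1 := by rcases hε with rfl | rfl <;> norm_num
    have hp : (z - w) ^ n * (z + w) ^ n = 1 := by rw [← mul_zpow, hprod, one_zpow]
    rw [hdef]
    calc Complex.exp (h * w) = ε * ε * ((z - w) ^ n * (z + w) ^ n) * Complex.exp (h * w) := by
          rw [hε2, hp]; ring
      _ = _ := by ring
  have hε1 : ‖ε‖ = 1 := by rcases hε with rfl | rfl <;> simp
  rw [← Real.exp_le_exp, ← Complex.norm_exp, hexp, norm_mul, norm_mul, hε1, one_mul]
  calc ‖x + y * w‖ * ‖(z - w) ^ n‖ ≤ 5 * r * Real.exp L * (5 * r) ^ n.natAbs := by gcongr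
    _ = Real.exp L * (5 * r) ^ (n.natAbs + 1) := by ring
    _ = Real.exp (L + (n.natAbs + 1) * Real.log (5 * r)) := by
      rw [Real.exp_add, mul_comm ((n.natAbs : ℝ) + 1), Real.exp_mul,
        Real.exp_log (by positivity)]
      norm_cast

/-- Here `w` is any choice, for each `z`, of a square root of `z² - 1`. -/
theorem theorem3p2 (x y h w : ℂ → ℂ) (ε : ℂ) (n : ℤ) (ρ : ℝ)
    (hw : ∀ z : ℂ, w z ^ 2 = z ^ 2 - 1)
    (hxy : IsEntirePellSolution x y)
    (hε : ε = -1 ∨ ε = 1)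
    (hh : Differentiable ℂ h)
    (hdef : ∀ z : ℂ, x z + y z * w z = ε * (z + w z) ^ n * Complex.exp (h z * w z))
    (hρ : 0 ≤ ρ)
    (hy : entireOrder y ≤ (ρ : EReal)) :
    ∃ p : Polynomial ℂ, (∀ z : ℂ, h z = p.eval z) ∧ intDegree p ≤ ⌊ρ⌋ - 1 := by
  obtain ⟨N, hN⟩ := Int.eq_ofNat_of_zero_le (Int.floor_nonneg.2 hρ)
  have hρN : ρ < (N : ℝ) + 1 := by
    have := Int.lt_floor_add_one ρ
    rw [hN] at this
    exact_mod_cast this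
  obtain ⟨α, C, hα, hαN, hC, hbound⟩ := exists_norm_le_exp_of_entireOrder_lt
    hxy.entire_y.continuous (hy.trans_lt (EReal.coe_lt_coe_iff.2 hρN))
  -- The second term comes from log t ≤ t^α/α at t = 5r.
  set M : ℝ := C + (n.natAbs + 1) * (5 ^ α / α) with hMdef
  have hM : 0 < M := by positivity
  -- The entire function `(z² - 1) h²` is the square of `h w`, whose real part is `O(r ^ α)`.
  have hre : ∀ᶠ r : ℝ in atTop, ∀ z : ℂ, ‖z‖ ≤ r →
      ((z ^ 2 - 1) * h z ^ 2).re ≤ M ^ 2 * r ^ (2 * α) := by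
    filter_upwards [hbound, eventually_ge_atTop 1] with r hr hr1 z hz
    have hr0 : 0 < r := by linarith
    have hlog : C * r ^ α + (n.natAbs + 1) * Real.log (5 * r) ≤ M * r ^ α := by
      have := Real.log_le_rpow_div (x := 5 * r) (by positivity) hα
      rw [Real.mul_rpow (by norm_num) hr0.le] at this
      calc C * r ^ α + (n.natAbs + 1) * Real.log (5 * r)
          ≤ C * r ^ α + (n.natAbs + 1) * (5 ^ α * r ^ α / α) := by gcongr
        _ = M * r ^ α := by rw [hMdef]; ring
    have h1 := (re_le_of_pell (hw z) (hxy.pell z) hε (hdef z) hr1 hz (by positivity)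
      (hr z hz)).trans hlog
    have h2 := (re_le_of_pell (w := -w z) (by rw [neg_sq, hw z]) (hxy.pell z) hε
      (pell_conj (hw z) (hxy.pell z) hε (hdef z)) hr1 hz (by positivity) (hr z hz)).trans hlog
    rw [mul_neg, Complex.neg_re] at h2
    have hsq : (z ^ 2 - 1) * h z ^ 2 = (h z * w z) ^ 2 := by rw [← hw z]; ring
    calc ((z ^ 2 - 1) * h z ^ 2).re = (h z * w z).re ^ 2 - (h z * w z).im ^ 2 := by
          rw [hsq, sq (h z * w z), Complex.mul_re]; ring
      _ ≤ (h z * w z).re ^ 2 := sub_le_self _ (sq_nonneg _)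
      _ ≤ (M * r ^ α) ^ 2 := sq_le_sq' (by linarith) h1
      _ = M ^ 2 * r ^ (2 * α) := by
        rw [mul_pow, mul_comm 2 α, Real.rpow_mul hr0.le, Real.rpow_two]
  obtain ⟨K, hK, hnorm⟩ := exists_norm_le_rpow_of_re_le_rpow
    (f := fun z => (z ^ 2 - 1) * h z ^ 2) (by fun_prop) (by positivity) (by positivity) hre
  obtain ⟨p, hp, hdeg⟩ := exists_polynomial_of_norm_le_rpow hh (β := α - 1) (N := N)
    (K := √(2 * K)) (by linarith) (by
      filter_upwards [hnorm, eventually_ge_atTop 2] with r hr hr2 z hz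
      have hr0 : 0 < r := by linarith
      have hlow : r ^ 2 / 2 ≤ ‖z ^ 2 - 1‖ := by
        have := norm_sub_norm_le (z ^ 2) 1
        rw [norm_pow, hz, norm_one] at this
        nlinarith
      have hle := hr z hz
      rw [norm_mul, norm_pow] at hle
      have hr2α : r ^ (2 * α) = (r ^ (α - 1)) ^ 2 * r ^ 2 := by
        rw [← mul_pow, ← Real.rpow_add_one hr0.ne', sub_add_cancel, mul_comm 2 α,
          Real.rpow_mul hr0.le, Real.rpow_two]
      refine (sq_le_sq₀ (norm_nonneg _) (by positivity)).1 ?_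
      rw [mul_pow, Real.sq_sqrt (by positivity)]
      refine le_of_mul_le_mul_left ?_ (by positivity : 0 < r ^ 2 / 2)
      calc r ^ 2 / 2 * ‖h z‖ ^ 2 ≤ ‖z ^ 2 - 1‖ * ‖h z‖ ^ 2 := by gcongr
        _ ≤ K * r ^ (2 * α) := hle
        _ = _ := by rw [hr2α]; ring)
  refine ⟨p, hp, ?_⟩
  rw [hN, intDegree]
  -- For N = 0 only p = 0 occurs, and the convention -1 is then exactly the bound.
  split_ifs with hp0
  · omega
  · have := (Polynomial.natDegree_lt_iff_degree_lt hp0).2 hdeg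
    omega
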